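/- Let $\mathbb D$ be a countably infinite set of data values; a trace is an infinite sequence $t\in\mathbb D^\omega$. **Logic.** Constraints are $b ::= \mathsf{true}\mid e=f\mid\neg b\mid b\wedge c$ with $e,f ::= x\mid\star$, where $x$ is a data variable and $\star$ denotes the current trace element. Formulae are built from $\mathsf{tt},\mathsf{ff},\langle b\rangle\varphi,[b]\varphi,\exists x.\varphi,\forall x.\varphi,\varphi\vee\psi,\varphi\wedge\psi,\min X.\varphi,\max X.\varphi,X$. A data environment $\delta$ is a finite partial map from data variables to $\mathbb D$. For a map $\rho$ from recursion variables to functions from data environments to sets of traces, $[\![\varphi,\rho,\delta]\!]\subseteq\mathbb D^\omega$ is defined by: $[\![\mathsf{tt},\rho,\delta]\!]=\mathbb D^\omega$, $[\![\mathsf{ff},\rho,\delta]\!]=\emptyset$; $dt'\in[\![\langle b\rangle\varphi,\rho,\delta]\!]$ iff $b$ is true under $\delta[\star\mapsto d]$ and $t'\in[\![\varphi,\rho,\delta]\!]$; $dt'\in[\![[b]\varphi,\rho,\delta]\!]$ iff $b$ being true under $\delta[\star\mapsto d]$ implies $t'\in[\![\varphi,\rho,\delta]\!]$; $\exists x$ and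 $\forall x$ are the union and intersection over $d\in\mathbb D$ of $[\![\varphi,\rho,\delta[x\mapsto d]]\!]$; $\vee,\wedge$ are union and intersection; $[\![X,\rho,\delta]\!]=\rho(X)(\delta)$; and $\min X.\varphi$, $\max X.\varphi$ denote the least and greatest fixed point of $F\mapsto(\delta'\mapsto[\![\varphi,\rho[X\mapsto F],\delta']\!])$ (for the pointwise inclusion order), evaluated at $\delta$. If $\varphi$ is closed (no free data or recursion variable) we write $[\![\varphi]\!]$. The fragment cHMLd has the constructs $\mathsf{tt},\langle b\rangle,\exists,\vee,\wedge,\min,X$, and sHMLd has $\mathsf{ff},[b],\forall,\vee,\wedge,\max,X$. A formula is guarded if every bound occurrence of a recursion variable lies under a modality inside its defining fixed-point formula. The dual $\overline\varphi$ exchanges $\mathsf{tt}/\mathsf{ff}$, $\langle b\rangle/[b]$, $\exists/\forall$, $\vee/\wedge$, $\min/\max$. **Monitors.** An abstract monitor consists of predicates $\mathbf{acc},\mathbf{rej}$ on finite traces that never hold together and are preserved when a finite trace is extended; it accepts (rejects) an infinite trace iff it accepts (rejects) some finite prefix of it. It is sound for $T\subseteq\mathbb D^\omega$ if accepted traces are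 in $T$ and rejected traces are not; it is satisfaction-complete (violation-complete) for $T$ if it accepts every $t\in T$ (rejects every $t\notin T$). $T$ is completely monitorable for satisfactions (violations) if some monitor is sound and satisfaction-complete (violation-complete) for $T$. Operational monitors are $m ::= \mathsf{yes}\mid\mathsf{end}\mid(b).m\mid\mathsf{guess}\,x.m\mid m\oplus n\mid m\otimes n\mid\mathsf{rec}X.m\mid X$. Configurations are pairs $(m,\delta)$ and parallel compositions $c\odot c'$ with $\odot\in\{\oplus,\otimes\}$. Transitions, labelled by $d\in\mathbb D$ or $\tau$, are: $(v,\delta)\xrightarrow{d}(v,\delta)$ for $v\in\{\mathsf{yes},\mathsf{end}\}$; $((b).m,\delta)\xrightarrow{d}(m,\delta)$ if $b$ is true under $\delta[\star\mapsto d]$, and $\xrightarrow{d}(\mathsf{end},\delta)$ if it is false; $(\mathsf{guess}\,x.m,\delta)\xrightarrow{\tau}(m,\delta[x\mapsto d])$ for every $d$; $(\mathsf{rec}X.m,\delta)\xrightarrow{\tau}(m[\mathsf{rec}X.m/X],\delta)$; $(m\odot n,\delta)\xrightarrow{\tau}(m,\delta)\odot(n,\delta)$; $c_1\odot c_2\xrightarrow{d}c_1'\odot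 c_2'$ if $c_i\xrightarrow{d}c_i'$ for $i=1,2$; $\tau$-steps of one component of a parallel composition; $(\mathsf{yes},\delta)\otimes c\xrightarrow{\tau}c$, $(\mathsf{yes},\delta)\oplus c\xrightarrow{\tau}(\mathsf{yes},\delta)$, and the symmetric versions of these two rules. A finite trace $w$ reaches $\mathsf{yes}$ in $m$ if $(m,\emptyset)$ can read $w$, with $\tau$-steps interleaved, and end in some $(\mathsf{yes},\delta')$. Synthesis is $\langle\!|\mathsf{tt}|\!\rangle=\mathsf{yes}$, $\langle\!|\langle b\rangle\varphi|\!\rangle=(b).\langle\!|\varphi|\!\rangle$, $\langle\!|\exists x.\varphi|\!\rangle=\mathsf{guess}\,x.\langle\!|\varphi|\!\rangle$, $\langle\!|\varphi\vee\psi|\!\rangle=\langle\!|\varphi|\!\rangle\oplus\langle\!|\psi|\!\rangle$, $\langle\!|\varphi\wedge\psi|\!\rangle=\langle\!|\varphi|\!\rangle\otimes\langle\!|\psi|\!\rangle$, $\langle\!|\min X.\varphi|\!\rangle=\mathsf{rec}X.\langle\!|\varphi|\!\rangle$, $\langle\!|X|\!\rangle=X$. **Theorem.** 1. For every closed guarded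 $\varphi\in$ cHMLd, the monitor that accepts the finite traces reaching $\mathsf{yes}$ in $\langle\!|\varphi|\!\rangle$ and never rejects is sound and satisfaction-complete for $[\![\varphi]\!]$. 2. For every closed $\varphi\in$ cHMLd, $[\![\varphi]\!]$ is completely monitorable for satisfactions. 3. For every closed guarded $\varphi\in$ sHMLd, the monitor that rejects the finite traces reaching $\mathsf{yes}$ in $\langle\!|\overline\varphi|\!\rangle$ and never accepts is sound and violation-complete for $[\![\varphi]\!]$. 4. For every closed $\varphi\in$ sHMLd, $[\![\varphi]\!]$ is completely monitorable for violations. -/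

import Mathlib

namespace RecHMLd

/-! ## Traces and data environments -/

/-- An infinite trace: an infinite sequence of data values. -/
abbrev Trace (D : Type*) := Stream' D

/-- The finite trace `w` is a prefix of the infinite trace `t`. -/
def PrefixOf {D : Type*} (w : List D) (t : Trace D) : Prop :=
  ∃ u : Trace D, t = w ++ₛ u

/-- A data environment: a partial function with finite domain from data variables to data
values. -/
structure DEnv (DVar D : Type*) where
  /-- the underlying partial function -/
  val : DVar → Option D
  finite_dom : {x | val x ≠ none}.Finite

/-- The empty data environment. -/
def DEnv.empty {DVar D : Type*} : DEnv DVar D where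
  val := fun _ => none
  finite_dom := by simp

/-- The environment `δ[x ↦ d]`, which overwrites a previous value of `x`, if any. -/
def DEnv.update {DVar D : Type*} [DecidableEq DVar] (δ : DEnv DVar D) (x : DVar) (d : D) :
    DEnv DVar D where
  val := Function.update δ.val x (some d)
  finite_dom := by
    refine (δ.finite_dom.insert x).subset ?_
    intro y hy
    by_cases h : y = x
    · exact Or.inl h
    · refine Or.inr ?_
      simpa [Function.update_of_ne h] using hy

/-! ## Constraint expressions -/

/-- Expressions: a data variable, or the placeholder `⋆` for the current trace element. -/
inductive Exp (DVar : Type*) where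
  | var (x : DVar)
  | star

/-- Boolean constraint expressions. -/
inductive BExp (DVar : Type*) where
  | tru
  | eq (e f : Exp DVar)
  | not (b : BExp DVar)
  | and (b c : BExp DVar)

/-- Value of an expression under `δ[⋆ ↦ d]`; undefined on variables outside the domain. -/
def Exp.eval {DVar D : Type*} (δ : DEnv DVar D) (d : D) : Exp DVar → Option D
  | .var x => δ.val x
  | .star => some d

/-- Truth value of a constraint under `δ[⋆ ↦ d]`; it is undefined (`none`) exactly when some data
variable of the constraint is not in the domain of `δ`. -/
def BExp.eval {DVar D : Type*} [DecidableEq D] (δ : DEnv DVar D) (d : D) :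
    BExp DVar → Option Bool
  | .tru => some true
  | .eq e f => Option.map₂ (fun a c => decide (a = c)) (e.eval δ d) (f.eval δ d)
  | .not b => (b.eval δ d).map Bool.not
  | .and b c => Option.map₂ Bool.and (b.eval δ d) (c.eval δ d)

/-- Data variables of an expression. -/
def Exp.vars {DVar : Type*} : Exp DVar → Set DVar
  | .var x => {x}
  | .star => ∅

/-- Data variables of a constraint. -/
def BExp.vars {DVar : Type*} : BExp DVar → Set DVar
  | .tru => ∅
  | .eq e f => e.vars ∪ f.vars
  | .not b => b.vars
  | .and b c => b.vars ∪ c.vars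

/-! ## Formulae -/

/-- Formulae of the logic: `tt`, `ff`, `⟨b⟩φ`, `[b]φ`, `∃x.φ`, `∀x.φ`, `φ ∨ ψ`, `φ ∧ ψ`,
`min X.φ`, `max X.φ`, `X`. -/
inductive Formula (FVar DVar : Type*) where
  | tt
  | ff
  | dia (b : BExp DVar) (φ : Formula FVar DVar)
  | box (b : BExp DVar) (φ : Formula FVar DVar)
  | ex (x : DVar) (φ : Formula FVar DVar)
  | all (x : DVar) (φ : Formula FVar DVar)
  | or (φ ψ : Formula FVar DVar)
  | and (φ ψ : Formula FVar DVar)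
  | lfp (X : FVar) (φ : Formula FVar DVar)
  | gfp (X : FVar) (φ : Formula FVar DVar)
  | var (X : FVar)

namespace Formula

variable {FVar DVar : Type*}

/-- Membership in the fragment cHMLd: `tt`, `⟨b⟩φ`, `∃x.φ`, `φ ∨ ψ`, `φ ∧ ψ`, `min X.φ`, `X`. -/
def IsCHML : Formula FVar DVar → Prop
  | .tt => True
  | .ff => False
  | .dia _ φ => φ.IsCHML
  | .box _ _ => False
  | .ex _ φ => φ.IsCHML
  | .all _ _ => False
  | .or φ ψ => φ.IsCHML ∧ ψ.IsCHML
  | .and φ ψ => φ.IsCHML ∧ ψ.IsCHML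
  | .lfp _ φ => φ.IsCHML
  | .gfp _ _ => False
  | .var _ => True

/-- Membership in the fragment sHMLd: `ff`, `[b]φ`, `∀x.φ`, `φ ∨ ψ`, `φ ∧ ψ`, `max X.φ`, `X`. -/
def IsSHML : Formula FVar DVar → Prop
  | .tt => False
  | .ff => True
  | .dia _ _ => False
  | .box _ φ => φ.IsSHML
  | .ex _ _ => False
  | .all _ φ => φ.IsSHML
  | .or φ ψ => φ.IsSHML ∧ ψ.IsSHML
  | .and φ ψ => φ.IsSHML ∧ ψ.IsSHML
  | .lfp _ _ => False
  | .gfp _ φ => φ.IsSHML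
  | .var _ => True

/-- Free recursion variables. -/
def freeFVars : Formula FVar DVar → Set FVar
  | .tt => ∅
  | .ff => ∅
  | .dia _ φ => φ.freeFVars
  | .box _ φ => φ.freeFVars
  | .ex _ φ => φ.freeFVars
  | .all _ φ => φ.freeFVars
  | .or φ ψ => φ.freeFVars ∪ ψ.freeFVars
  | .and φ ψ => φ.freeFVars ∪ ψ.freeFVars
  | .lfp X φ => φ.freeFVars \ {X}
  | .gfp X φ => φ.freeFVars \ {X}
  | .var X => {X}

/-- Free data variables. -/
def freeDVars : Formula FVar DVar → Set DVar
  | .tt => ∅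
  | .ff => ∅
  | .dia b φ => b.vars ∪ φ.freeDVars
  | .box b φ => b.vars ∪ φ.freeDVars
  | .ex x φ => φ.freeDVars \ {x}
  | .all x φ => φ.freeDVars \ {x}
  | .or φ ψ => φ.freeDVars ∪ ψ.freeDVars
  | .and φ ψ => φ.freeDVars ∪ ψ.freeDVars
  | .lfp _ φ => φ.freeDVars
  | .gfp _ φ => φ.freeDVars
  | .var _ => ∅

/-- A formula is closed if it has neither free recursion variables nor free data variables. -/
def Closed (φ : Formula FVar DVar) : Prop :=
  φ.freeFVars = ∅ ∧ φ.freeDVars = ∅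

/-- Every free occurrence of `X` in the formula is within the scope of a modal operator. -/
def GuardedIn (X : FVar) : Formula FVar DVar → Prop
  | .tt => True
  | .ff => True
  | .dia _ _ => True
  | .box _ _ => True
  | .ex _ φ => φ.GuardedIn X
  | .all _ φ => φ.GuardedIn X
  | .or φ ψ => φ.GuardedIn X ∧ ψ.GuardedIn X
  | .and φ ψ => φ.GuardedIn X ∧ ψ.GuardedIn X
  | .lfp Y φ => Y = X ∨ φ.GuardedIn X
  | .gfp Y φ => Y = X ∨ φ.GuardedIn X
  | .var Y => Y ≠ X

/-- Every bound occurrence of a recursion variable is within the scope of a modal operator in its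
defining fixed-point formula. -/
def Guarded : Formula FVar DVar → Prop
  | .tt => True
  | .ff => True
  | .dia _ φ => φ.Guarded
  | .box _ φ => φ.Guarded
  | .ex _ φ => φ.Guarded
  | .all _ φ => φ.Guarded
  | .or φ ψ => φ.Guarded ∧ ψ.Guarded
  | .and φ ψ => φ.Guarded ∧ ψ.Guarded
  | .lfp X φ => φ.GuardedIn X ∧ φ.Guarded
  | .gfp X φ => φ.GuardedIn X ∧ φ.Guarded
  | .var _ => True

/-- The syntactic dual of a formula, which exchanges `tt`/`ff`, `⟨b⟩`/`[b]`, `∃`/`∀`, `∨`/`∧` and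
`min`/`max`. For closed formulae it expresses the negation, and it maps sHMLd onto cHMLd. -/
def dual : Formula FVar DVar → Formula FVar DVar
  | .tt => .ff
  | .ff => .tt
  | .dia b φ => .box b φ.dual
  | .box b φ => .dia b φ.dual
  | .ex x φ => .all x φ.dual
  | .all x φ => .ex x φ.dual
  | .or φ ψ => .and φ.dual ψ.dual
  | .and φ ψ => .or φ.dual ψ.dual
  | .lfp X φ => .gfp X φ.dual
  | .gfp X φ => .lfp X φ.dual
  | .var X => .var X

end Formula

/-! ## Linear-time semantics -/

/-- Data interpretations, ordered pointwise by inclusion. -/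
abbrev DInt (DVar D : Type*) := DEnv DVar D → Set (Trace D)

/-- Trace environments. They are total here: the semantics reads them only at free recursion
variables. -/
abbrev TEnv (FVar DVar D : Type*) := FVar → DInt DVar D

/-- The denotation of a formula in a trace environment `ρ` and a data environment `δ`. -/
def Formula.sem {FVar DVar D : Type*} [DecidableEq FVar] [DecidableEq DVar] [DecidableEq D] :
    Formula FVar DVar → TEnv FVar DVar D → DEnv DVar D → Set (Trace D)
  | .tt, _, _ => Set.univ
  | .ff, _, _ => ∅
  | .dia b φ, ρ, δ =>
      {t | ∃ (d : D) (u : Trace D),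
        t = Stream'.cons d u ∧ b.eval δ d = some true ∧ u ∈ φ.sem ρ δ}
  | .box b φ, ρ, δ =>
      {t | ∀ (d : D) (u : Trace D),
        (t = Stream'.cons d u ∧ b.eval δ d = some true) → u ∈ φ.sem ρ δ}
  | .ex x φ, ρ, δ => ⋃ d : D, φ.sem ρ (δ.update x d)
  | .all x φ, ρ, δ => ⋂ d : D, φ.sem ρ (δ.update x d)
  | .or φ ψ, ρ, δ => φ.sem ρ δ ∪ ψ.sem ρ δ
  | .and φ ψ, ρ, δ => φ.sem ρ δ ∩ ψ.sem ρ δ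
  | .lfp X φ, ρ, δ =>
      (sInf {F : DInt DVar D | (fun δ' => φ.sem (Function.update ρ X F) δ') ≤ F}) δ
  | .gfp X φ, ρ, δ =>
      (sSup {F : DInt DVar D | F ≤ (fun δ' => φ.sem (Function.update ρ X F) δ')}) δ
  | .var X, ρ, δ => ρ X δ

/-- The set of traces satisfying a closed formula, whose denotation depends on neither
environment. -/
def Formula.traces {FVar DVar : Type*} (D : Type*) [DecidableEq FVar] [DecidableEq DVar]
    [DecidableEq D] (φ : Formula FVar DVar) : Set (Trace D) :=
  φ.sem (fun _ _ => ∅) DEnv.empty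

/-! ## Monitors and monitorability -/

/-- A monitor as seen from outside: acceptance and rejection predicates on finite traces, which
never hold together and are irrevocable. -/
structure Monitor (D : Type*) where
  acc : List D → Prop
  rej : List D → Prop
  consistent : ∀ w, ¬ (acc w ∧ rej w)
  acc_irrevocable : ∀ w y, w <+: y → acc w → acc y
  rej_irrevocable : ∀ w y, w <+: y → rej w → rej y

namespace Monitor

variable {D : Type*}

/-- The monitor accepts the infinite trace `t`. -/
def Accepts (m : Monitor D) (t : Trace D) : Prop := ∃ w, PrefixOf w t ∧ m.acc w

/-- The monitor rejects the infinite trace `t`. -/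
def Rejects (m : Monitor D) (t : Trace D) : Prop := ∃ w, PrefixOf w t ∧ m.rej w

def SoundForSatisfactions (m : Monitor D) (T : Set (Trace D)) : Prop :=
  ∀ t, m.Accepts t → t ∈ T

def SoundForViolations (m : Monitor D) (T : Set (Trace D)) : Prop :=
  ∀ t, m.Rejects t → t ∉ T

/-- Soundness, for both satisfactions and violations. -/
def Sound (m : Monitor D) (T : Set (Trace D)) : Prop :=
  m.SoundForSatisfactions T ∧ m.SoundForViolations T

def CompleteForSatisfactions (m : Monitor D) (T : Set (Trace D)) : Prop :=
  ∀ t, t ∈ T → m.Accepts t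

def CompleteForViolations (m : Monitor D) (T : Set (Trace D)) : Prop :=
  ∀ t, t ∉ T → m.Rejects t

end Monitor

/-- Some sound monitor detects all satisfactions of `T`. -/
def CompletelyMonitorableForSatisfactions {D : Type*} (T : Set (Trace D)) : Prop :=
  ∃ m : Monitor D, m.Sound T ∧ m.CompleteForSatisfactions T

/-- Some sound monitor detects all violations of `T`. -/
def CompletelyMonitorableForViolations {D : Type*} (T : Set (Trace D)) : Prop :=
  ∃ m : Monitor D, m.Sound T ∧ m.CompleteForViolations T

/-! ## Operational monitors -/

/-- The two parallel compositions: `⊕` (parallel OR) and `⊗` (parallel AND). -/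
inductive ParOp where
  | oplus
  | otimes

/-- Monitors: the verdicts `yes` and `end`, `(b).m`, `guess x.m`, `m ⊙ n`, `rec X.m`, `X`. -/
inductive Mon (FVar DVar : Type*) where
  | yes
  | inconclusive
  | act (b : BExp DVar) (m : Mon FVar DVar)
  | guess (x : DVar) (m : Mon FVar DVar)
  | par (o : ParOp) (m n : Mon FVar DVar)
  | recur (X : FVar) (m : Mon FVar DVar)
  | var (X : FVar)

/-- `m.subst X n` replaces the free occurrences of the recursion variable `X` in `m` by `n`. Runs
of a closed monitor substitute only monitors without free recursion variables, so there is no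
capture of recursion variables. Data variables are not renamed: a guess overwrites the
environment. -/
def Mon.subst {FVar DVar : Type*} [DecidableEq FVar] :
    Mon FVar DVar → FVar → Mon FVar DVar → Mon FVar DVar
  | .yes, _, _ => .yes
  | .inconclusive, _, _ => .inconclusive
  | .act b m, X, n => .act b (m.subst X n)
  | .guess x m, X, n => .guess x (m.subst X n)
  | .par o m₁ m₂, X, n => .par o (m₁.subst X n) (m₂.subst X n)
  | .recur Y m, X, n => if Y = X then .recur Y m else .recur Y (m.subst X n)
  | .var Y, X, n => if Y = X then n else .var Y

/-- Configurations: a monitor with its data environment, or a parallel composition. -/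
inductive Config (FVar DVar D : Type*) where
  | single (m : Mon FVar DVar) (δ : DEnv DVar D)
  | par (o : ParOp) (c₁ c₂ : Config FVar DVar D)

/-- The small-step semantics. The label `none` is the silent action `τ`, and `some d` processes the
trace element `d`. The rules that aggregate a verdict `yes` come with their symmetric versions. -/
inductive Step {FVar DVar D : Type*} [DecidableEq FVar] [DecidableEq DVar] [DecidableEq D] :
    Option D → Config FVar DVar D → Config FVar DVar D → Prop
  | vrdYes (d : D) (δ : DEnv DVar D) : Step (some d) (.single .yes δ) (.single .yes δ)
  | vrdEnd (d : D) (δ : DEnv DVar D) :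
      Step (some d) (.single .inconclusive δ) (.single .inconclusive δ)
  | act (d : D) (b : BExp DVar) (m : Mon FVar DVar) (δ : DEnv DVar D) :
      b.eval δ d = some true → Step (some d) (.single (.act b m) δ) (.single m δ)
  | block (d : D) (b : BExp DVar) (m : Mon FVar DVar) (δ : DEnv DVar D) :
      b.eval δ d = some false →
        Step (some d) (.single (.act b m) δ) (.single .inconclusive δ)
  | guess (d : D) (x : DVar) (m : Mon FVar DVar) (δ : DEnv DVar D) :
      Step none (.single (.guess x m) δ) (.single m (δ.update x d))
  | unfold (X : FVar) (m : Mon FVar DVar) (δ : DEnv DVar D) :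
      Step none (.single (.recur X m) δ) (.single (m.subst X (.recur X m)) δ)
  | fork (o : ParOp) (m n : Mon FVar DVar) (δ : DEnv DVar D) :
      Step none (.single (.par o m n) δ) (.par o (.single m δ) (.single n δ))
  | sync (d : D) (o : ParOp) (c₁ c₁' c₂ c₂' : Config FVar DVar D) :
      Step (some d) c₁ c₁' → Step (some d) c₂ c₂' →
        Step (some d) (.par o c₁ c₂) (.par o c₁' c₂')
  | asyncL (o : ParOp) (c₁ c₁' c₂ : Config FVar DVar D) :
      Step none c₁ c₁' → Step none (.par o c₁ c₂) (.par o c₁' c₂)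
  | asyncR (o : ParOp) (c₁ c₂ c₂' : Config FVar DVar D) :
      Step none c₂ c₂' → Step none (.par o c₁ c₂) (.par o c₁ c₂')
  | andYesL (δ : DEnv DVar D) (c : Config FVar DVar D) :
      Step none (.par .otimes (.single .yes δ) c) c
  | andYesR (δ : DEnv DVar D) (c : Config FVar DVar D) :
      Step none (.par .otimes c (.single .yes δ)) c
  | orYesL (δ : DEnv DVar D) (c : Config FVar DVar D) :
      Step none (.par .oplus (.single .yes δ) c) (.single .yes δ)
  | orYesR (δ : DEnv DVar D) (c : Config FVar DVar D) :
      Step none (.par .oplus c (.single .yes δ)) (.single .yes δ)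

section Operational

variable {FVar DVar D : Type*} [DecidableEq FVar] [DecidableEq DVar] [DecidableEq D]

/-- Finitely many silent steps. -/
def TauSteps : Config FVar DVar D → Config FVar DVar D → Prop :=
  Relation.ReflTransGen (Step none)

/-- `c ⇒ c'` processing one trace element `d`, with silent steps before and after. -/
def WeakStep (d : D) (c c' : Config FVar DVar D) : Prop :=
  ∃ c₁ c₂, TauSteps c c₁ ∧ Step (some d) c₁ c₂ ∧ TauSteps c₂ c'

/-- `c ⇒ c'` processing the finite trace. -/
def WeakSteps : List D → Config FVar DVar D → Config FVar DVar D → Prop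
  | [], c, c' => TauSteps c c'
  | d :: w, c, c' => ∃ c₁, WeakStep d c c₁ ∧ WeakSteps w c₁ c'

/-- The configuration can reach the verdict `yes` by processing the finite trace `w`. -/
def Config.ReachesYes (c : Config FVar DVar D) (w : List D) : Prop :=
  ∃ δ' : DEnv DVar D, WeakSteps w c (.single .yes δ')

theorem WeakSteps.append_yes {c c' : Config FVar DVar D} {w y : List D}
    {δ : DEnv DVar D} (h : WeakSteps w c c') (hc : c' = .single .yes δ) :
    WeakSteps (w ++ y) c (.single .yes δ) := by
  induction w generalizing c with
  | nil =>
    subst hc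
    cases y with
    | nil => exact h
    | cons d y =>
      refine ⟨_, ⟨_, _, h, Step.vrdYes d δ, Relation.ReflTransGen.refl⟩, ?_⟩
      induction y with
      | nil => exact Relation.ReflTransGen.refl
      | cons e y ih =>
        exact ⟨_, ⟨_, _, Relation.ReflTransGen.refl, Step.vrdYes e δ,
          Relation.ReflTransGen.refl⟩, ih⟩
  | cons d w ih =>
    obtain ⟨c₁, h₁, h₂⟩ := h
    exact ⟨c₁, h₁, ih h₂⟩

/-- The verdict `yes` is irrevocable. -/
theorem Config.ReachesYes.mono {c : Config FVar DVar D} {w y : List D} (hwy : w <+: y)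
    (h : c.ReachesYes w) : c.ReachesYes y := by
  obtain ⟨z, rfl⟩ := hwy
  obtain ⟨δ, h⟩ := h
  exact ⟨δ, WeakSteps.append_yes h rfl⟩

variable (D) in
/-- The monitor that executes `m` from the empty data environment, accepts on `yes` and never
rejects. -/
def Mon.acceptor (m : Mon FVar DVar) : Monitor D where
  acc w := (Config.single m (DEnv.empty : DEnv DVar D)).ReachesYes w
  rej _ := False
  consistent _ h := h.2
  acc_irrevocable _ _ hwy h := h.mono hwy
  rej_irrevocable _ _ _ h := h

variable (D) in
/-- The single-verdict monitor for violations that executes `m` from the empty data environment,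
where the verdict `yes` of `m` is read as a rejection; it never accepts. (Up to renaming the verdict
to `no` and exchanging `⊕` and `⊗`, this is the dual monitor model.) -/
def Mon.rejector (m : Mon FVar DVar) : Monitor D where
  acc _ := False
  rej w := (Config.single m (DEnv.empty : DEnv DVar D)).ReachesYes w
  consistent _ h := h.1
  acc_irrevocable _ _ _ h := h
  rej_irrevocable _ _ hwy h := h.mono hwy

end Operational

/-! ## Synthesis -/

/-- Compositional monitor synthesis on cHMLd. The constructs outside cHMLd are sent to the
inconclusive verdict; this is irrelevant for formulae of cHMLd. -/
def Formula.synth {FVar DVar : Type*} : Formula FVar DVar → Mon FVar DVar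
  | .tt => .yes
  | .dia b φ => .act b φ.synth
  | .ex x φ => .guess x φ.synth
  | .or φ ψ => .par .oplus φ.synth ψ.synth
  | .and φ ψ => .par .otimes φ.synth ψ.synth
  | .lfp X φ => .recur X φ.synth
  | .var X => .var X
  | .ff => .inconclusive
  | .box _ _ => .inconclusive
  | .all _ _ => .inconclusive
  | .gfp _ _ => .inconclusive

end RecHMLd

set_option linter.unusedSectionVars false

namespace RecHMLd

/-! ## Prefixes and open sets of traces -/

section Prefixes

variable {D : Type*}

/-! Monitors receive a denotation `Mon.sem` that copies the semantics of cHMLd clause by clause, so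
`Formula.sem_synth` reduces everything to comparing this denotation with the traces on which runs
reach `yes`.

Soundness: a silent step of a closed configuration can only shrink the denotation, and if c reads d
and becomes c', then du belongs to c whenever u belongs to c'. Since `yes` denotes all traces, every
extension of an accepted prefix lies in the denotation (`WeakSteps.append_mem_sem`). Guardedness
plays no role here.

Completeness (`Mon.sem_subset_accepted_msubst`) is by structural induction on open monitors under a
closing substitution. At a recursion, the traces accepted by its runnable instances form a pre-fixed
point of the body, hence contain the least one. The delicate case is ⊕: both components must read
every datum, so one that is stuck would keep the other from reporting `yes`. For instance, the
monitor of ⟨true⟩tt ∨ min X.X never reads anything. Guardedness and defined data variables exclude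
this (`Mon.Runnable.exists_weakStep`).

Without guardedness the argument is topological: denotations of monitors are open for the prefix
topology (`Mon.sem_subset_interior`), and an open set is detected by the monitor that accepts w once
all extensions of w belong to the set. The claims on sHMLd follow because the dual denotes the
complement (`Formula.sem_dual`). -/

theorem PrefixOf.eq_take {w : List D} {t : Trace D} (h : PrefixOf w t) : w = t.take w.length := by
  obtain ⟨u, rfl⟩ := h
  induction w with
  | nil => rfl
  | cons d w ih => exact congrArg (List.cons d) ih

theorem PrefixOf.nil (t : Trace D) : PrefixOf [] t := ⟨t, rfl⟩

theorem PrefixOf.cons {w : List D} {t : Trace D} (d : D) (h : PrefixOf w t) :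
    PrefixOf (d :: w) (Stream'.cons d t) := by
  obtain ⟨u, rfl⟩ := h
  exact ⟨u, rfl⟩

/-- Two prefixes of the same trace are comparable. -/
theorem PrefixOf.total {w y : List D} {t : Trace D} (hw : PrefixOf w t) (hy : PrefixOf y t) :
    w <+: y ∨ y <+: w := by
  rw [hw.eq_take, hy.eq_take]
  rcases le_total w.length y.length with h | h
  · left
    rw [← min_eq_right h, ← Stream'.take_take]
    exact List.take_prefix _ _
  · right
    rw [← min_eq_right h, ← Stream'.take_take]
    exact List.take_prefix _ _

/-- The traces with a prefix all of whose infinite extensions are in `T`. -/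
def traceInterior (T : Set (Trace D)) : Set (Trace D) :=
  {t | ∃ w, PrefixOf w t ∧ ∀ u : Trace D, w ++ₛ u ∈ T}

theorem traceInterior_subset (T : Set (Trace D)) : traceInterior T ⊆ T := by
  rintro _ ⟨w, ⟨u, rfl⟩, h⟩
  exact h u

theorem traceInterior_mono {S T : Set (Trace D)} (h : S ⊆ T) :
    traceInterior S ⊆ traceInterior T :=
  fun _ ⟨w, hw, hS⟩ => ⟨w, hw, fun u => h (hS u)⟩

theorem subset_traceInterior_traceInterior (T : Set (Trace D)) :
    traceInterior T ⊆ traceInterior (traceInterior T) :=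
  fun _ ⟨w, hw, hT⟩ => ⟨w, hw, fun u => ⟨w, ⟨u, rfl⟩, hT⟩⟩

/-- A set of traces whose members are all witnessed by a finite prefix is completely monitorable
for satisfactions. -/
theorem completelyMonitorableForSatisfactions_of_subset_interior {T : Set (Trace D)}
    (hT : T ⊆ traceInterior T) : CompletelyMonitorableForSatisfactions T := by
  refine ⟨⟨fun w => ∀ u : Trace D, w ++ₛ u ∈ T, fun _ => False, fun _ h => h.2, ?_,
    fun _ _ _ h => h⟩, ⟨fun t ht => traceInterior_subset T ht, fun t ht => ht.elim fun _ h => h.2.elim⟩,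
    fun t ht => hT ht⟩
  rintro w _ ⟨z, rfl⟩ h u
  rw [Stream'.append_append_stream]
  exact h _

/-- A set of traces whose non-members are all witnessed by a finite prefix is completely monitorable
for violations. -/
theorem completelyMonitorableForViolations_of_compl_subset_interior {T : Set (Trace D)}
    (hT : Tᶜ ⊆ traceInterior Tᶜ) : CompletelyMonitorableForViolations T := by
  refine ⟨⟨fun _ => False, fun w => ∀ u : Trace D, w ++ₛ u ∈ Tᶜ, fun _ h => h.1,
    fun _ _ _ h => h, ?_⟩, ⟨fun t ht => ht.elim fun _ h => h.2.elim, fun t ht => traceInterior_subset Tᶜ ht⟩,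
    fun t ht => hT ht⟩
  rintro w _ ⟨z, rfl⟩ h u
  rw [Stream'.append_append_stream]
  exact h _

end Prefixes

/-! ## Syntax of monitors -/

namespace Mon

variable {FVar DVar : Type*}

/-- Free recursion variables of a monitor. -/
def freeFVars : Mon FVar DVar → Set FVar
  | .yes => ∅
  | .inconclusive => ∅
  | .act _ m => m.freeFVars
  | .guess _ m => m.freeFVars
  | .par _ m n => m.freeFVars ∪ n.freeFVars
  | .recur X m => m.freeFVars \ {X}
  | .var X => {X}

/-- Free data variables of a monitor. -/
def freeDVars : Mon FVar DVar → Set DVar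
  | .yes => ∅
  | .inconclusive => ∅
  | .act b m => b.vars ∪ m.freeDVars
  | .guess x m => m.freeDVars \ {x}
  | .par _ m n => m.freeDVars ∪ n.freeDVars
  | .recur _ m => m.freeDVars
  | .var _ => ∅

/-- Every free occurrence of `X` in the monitor is under a constraint prefix. -/
def GuardedIn (X : FVar) : Mon FVar DVar → Prop
  | .yes => True
  | .inconclusive => True
  | .act _ _ => True
  | .guess _ m => m.GuardedIn X
  | .par _ m n => m.GuardedIn X ∧ n.GuardedIn X
  | .recur Y m => Y = X ∨ m.GuardedIn X
  | .var Y => Y ≠ X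

/-- Every bound occurrence of a recursion variable is under a constraint prefix in its defining
recursion. -/
def Guarded : Mon FVar DVar → Prop
  | .yes => True
  | .inconclusive => True
  | .act _ m => m.Guarded
  | .guess _ m => m.Guarded
  | .par _ m n => m.Guarded ∧ n.Guarded
  | .recur X m => m.GuardedIn X ∧ m.Guarded
  | .var _ => True

/-- Number of constructors that are not under a constraint prefix; it bounds the number of silent
steps of a guarded monitor. -/
def unguardedSize : Mon FVar DVar → ℕ
  | .yes => 0
  | .inconclusive => 0
  | .act _ _ => 0
  | .guess _ m => m.unguardedSize + 1
  | .par _ m n => m.unguardedSize + n.unguardedSize + 1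
  | .recur _ m => m.unguardedSize + 1
  | .var _ => 0

theorem guardedIn_of_notMem_freeFVars {X : FVar} {m : Mon FVar DVar} (h : X ∉ m.freeFVars) :
    m.GuardedIn X := by
  induction m with
  | yes | inconclusive | act => trivial
  | guess x m ih => exact ih h
  | par o m n ihm ihn => exact ⟨ihm fun hm => h (Or.inl hm), ihn fun hn => h (Or.inr hn)⟩
  | recur Y m ih =>
    by_cases hY : Y = X
    · exact Or.inl hY
    · exact Or.inr (ih fun hm => h ⟨hm, fun e => hY (Set.mem_singleton_iff.1 e).symm⟩)
  | var Y => exact fun e => h e.symm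

/-! ### Substitution for recursion variables, single and simultaneous. -/

variable [DecidableEq FVar]

theorem subst_eq_self {X : FVar} {m : Mon FVar DVar} (n : Mon FVar DVar) (h : X ∉ m.freeFVars) :
    m.subst X n = m := by
  induction m with
  | yes | inconclusive => rfl
  | act b m ih => rw [subst, ih h]
  | guess x m ih => rw [subst, ih h]
  | par o m₁ m₂ ih₁ ih₂ =>
    rw [subst, ih₁ fun hm => h (Or.inl hm), ih₂ fun hn => h (Or.inr hn)]
  | recur Y m ih =>
    rw [subst]
    split_ifs with hY
    · rfl
    · rw [ih fun hm => h ⟨hm, fun e => hY (Set.mem_singleton_iff.1 e).symm⟩]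
  | var Y =>
    rw [subst, if_neg]
    exact fun e => h e.symm

/-- The bound survives capture: a binder in `m` that captures a variable of `n` only removes it from
the left side. -/
theorem freeFVars_subst_subset (m : Mon FVar DVar) (X : FVar) (n : Mon FVar DVar) :
    (m.subst X n).freeFVars ⊆ (m.freeFVars \ {X}) ∪ n.freeFVars := by
  induction m with
  | yes | inconclusive => exact Set.empty_subset _
  | act b m ih => exact ih
  | guess x m ih => exact ih
  | par o m₁ m₂ ih₁ ih₂ =>
    rintro Z (h | h)
    · rcases ih₁ h with h | h
      · exact Or.inl ⟨Or.inl h.1, h.2⟩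
      · exact Or.inr h
    · rcases ih₂ h with h | h
      · exact Or.inl ⟨Or.inr h.1, h.2⟩
      · exact Or.inr h
  | recur Y m ih =>
    rw [subst]
    split_ifs with hY
    · subst hY
      exact fun Z h => Or.inl ⟨h, h.2⟩
    · rintro Z ⟨h, hZ⟩
      rcases ih h with h | h
      · exact Or.inl ⟨⟨h.1, hZ⟩, h.2⟩
      · exact Or.inr h
  | var Y =>
    rw [subst]
    split_ifs with hY
    · exact Set.subset_union_right
    · rintro Z rfl
      exact Or.inl ⟨rfl, hY⟩

theorem freeDVars_subst_subset (m : Mon FVar DVar) (X : FVar) (n : Mon FVar DVar) :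
    (m.subst X n).freeDVars ⊆ m.freeDVars ∪ n.freeDVars := by
  induction m with
  | yes | inconclusive => exact Set.empty_subset _
  | act b m ih =>
    rintro z (h | h)
    · exact Or.inl (Or.inl h)
    · exact (ih h).imp Or.inr id
  | guess x m ih => exact fun z h => (ih h.1).imp (fun h' => ⟨h', h.2⟩) id
  | par o m₁ m₂ ih₁ ih₂ =>
    rintro z (h | h)
    · exact (ih₁ h).imp Or.inl id
    · exact (ih₂ h).imp Or.inr id
  | recur Y m ih =>
    rw [subst]
    split_ifs with hY
    · exact Set.subset_union_left
    · exact ih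
  | var Y =>
    rw [subst]
    split_ifs with hY
    · exact Set.subset_union_right
    · exact Set.empty_subset _

theorem GuardedIn.subst {Y : FVar} {m : Mon FVar DVar} (h : m.GuardedIn Y) (X : FVar)
    {n : Mon FVar DVar} (hn : n.freeFVars = ∅) : (m.subst X n).GuardedIn Y := by
  induction m with
  | yes | inconclusive | act => trivial
  | guess x m ih => exact ih h
  | par o m₁ m₂ ih₁ ih₂ => exact ⟨ih₁ h.1, ih₂ h.2⟩
  | recur Z m ih =>
    rw [Mon.subst]
    split_ifs with hZ
    · exact h
    · exact h.imp id ih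
  | var Z =>
    rw [Mon.subst]
    split_ifs with hZ
    · exact guardedIn_of_notMem_freeFVars (by simp [hn])
    · exact h

theorem Guarded.subst {m : Mon FVar DVar} (h : m.Guarded) (X : FVar) {n : Mon FVar DVar}
    (hn : n.freeFVars = ∅) (hg : n.Guarded) : (m.subst X n).Guarded := by
  induction m with
  | yes | inconclusive => trivial
  | act b m ih => exact ih h
  | guess x m ih => exact ih h
  | par o m₁ m₂ ih₁ ih₂ => exact ⟨ih₁ h.1, ih₂ h.2⟩
  | recur Z m ih =>
    rw [Mon.subst]
    split_ifs with hZ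
    · exact h
    · exact ⟨h.1.subst X hn, ih h.2⟩
  | var Z =>
    rw [Mon.subst]
    split_ifs with hZ
    · exact hg
    · trivial

/-- Guarded occurrences of `X` sit below an `act`, which counts 0 whatever follows it. Hence
unfolding a guarded recursion lowers the measure by one, although the monitor may grow. -/
theorem unguardedSize_subst {X : FVar} {m : Mon FVar DVar} (h : m.GuardedIn X)
    (n : Mon FVar DVar) : (m.subst X n).unguardedSize = m.unguardedSize := by
  induction m with
  | yes | inconclusive | act => rfl
  | guess x m ih => simp only [subst, unguardedSize, ih h]
  | par o m₁ m₂ ih₁ ih₂ => simp only [subst, unguardedSize, ih₁ h.1, ih₂ h.2]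
  | recur Z m ih =>
    rw [subst]
    split_ifs with hZ
    · rfl
    · simp only [unguardedSize, ih (h.resolve_left hZ)]
  | var Z => rw [subst, if_neg h]

/-- Simultaneous replacement of the free recursion variables of a monitor. -/
def msubst : Mon FVar DVar → (FVar → Mon FVar DVar) → Mon FVar DVar
  | .yes, _ => .yes
  | .inconclusive, _ => .inconclusive
  | .act b m, σ => .act b (m.msubst σ)
  | .guess x m, σ => .guess x (m.msubst σ)
  | .par o m n, σ => .par o (m.msubst σ) (n.msubst σ)
  | .recur Y m, σ => .recur Y (m.msubst (Function.update σ Y (.var Y)))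
  | .var Y, σ => σ Y

theorem msubst_eq_self {m : Mon FVar DVar} {σ : FVar → Mon FVar DVar}
    (h : ∀ Y ∈ m.freeFVars, σ Y = .var Y) : m.msubst σ = m := by
  induction m generalizing σ with
  | yes | inconclusive => rfl
  | act b m ih => rw [msubst, ih h]
  | guess x m ih => rw [msubst, ih h]
  | par o m n ihm ihn =>
    rw [msubst, ihm fun Y hY => h Y (Or.inl hY), ihn fun Y hY => h Y (Or.inr hY)]
  | recur X m ih =>
    rw [msubst, ih]
    intro Y hY
    by_cases hX : Y = X
    · subst hX
      rw [Function.update_self]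
    · rw [Function.update_of_ne hX, h Y ⟨hY, hX⟩]
  | var Y => exact h Y rfl

/-- The left side is what the unfolding rule produces from an instantiated recursion; the right side
is the form to which an induction hypothesis on the body applies. The condition on σ keeps the outer
substitution from touching what σ has inserted. -/
theorem msubst_update_var_subst (m : Mon FVar DVar) {σ : FVar → Mon FVar DVar} {X : FVar}
    (n : Mon FVar DVar) (hσ : ∀ Y, Y ≠ X → X ∉ (σ Y).freeFVars) :
    (m.msubst (Function.update σ X (.var X))).subst X n = m.msubst (Function.update σ X n) := by
  induction m generalizing σ with
  | yes | inconclusive => rfl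
  | act b m ih => rw [msubst, subst, ih hσ, msubst]
  | guess x m ih => rw [msubst, subst, ih hσ, msubst]
  | par o m₁ m₂ ih₁ ih₂ => rw [msubst, subst, ih₁ hσ, ih₂ hσ, msubst]
  | recur Y m ih =>
    rw [msubst, subst, msubst]
    split_ifs with hY
    · subst hY
      rw [Function.update_idem, Function.update_idem]
    · rw [Function.update_comm (Ne.symm hY) (var X) (var Y) σ,
        Function.update_comm (Ne.symm hY) n (var Y) σ, ih]
      intro Z hZ
      by_cases hZY : Z = Y
      · subst hZY
        rw [Function.update_self]
        exact fun e => hY (Set.mem_singleton_iff.1 e).symm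
      · rw [Function.update_of_ne hZY]
        exact hσ Z hZ
  | var Y =>
    by_cases hY : Y = X
    · subst hY
      rw [msubst, msubst, Function.update_self, Function.update_self, subst, if_pos rfl]
    · rw [msubst, msubst, Function.update_of_ne hY, Function.update_of_ne hY]
      exact subst_eq_self n (hσ Y hY)

end Mon

/-! ## Denotations of monitors -/

section Denotation

variable {FVar DVar D : Type*}

/-- The operation on sets of traces that corresponds to a parallel composition. -/
def ParOp.sem : ParOp → Set (Trace D) → Set (Trace D) → Set (Trace D)
  | .oplus, S, T => S ∪ T
  | .otimes, S, T => S ∩ T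

theorem ParOp.sem_mono (o : ParOp) {S S' T T' : Set (Trace D)} (hS : S ⊆ S') (hT : T ⊆ T') :
    o.sem S T ⊆ o.sem S' T' := by
  cases o
  · exact Set.union_subset_union hS hT
  · exact Set.inter_subset_inter hS hT

variable [DecidableEq FVar] [DecidableEq DVar] [DecidableEq D]

/-- The set of traces that a monitor is meant to accept. -/
def Mon.sem : Mon FVar DVar → TEnv FVar DVar D → DEnv DVar D → Set (Trace D)
  | .yes, _, _ => Set.univ
  | .inconclusive, _, _ => ∅
  | .act b m, ρ, δ =>
      {t | ∃ (d : D) (u : Trace D),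
        t = Stream'.cons d u ∧ b.eval δ d = some true ∧ u ∈ m.sem ρ δ}
  | .guess x m, ρ, δ => ⋃ d : D, m.sem ρ (δ.update x d)
  | .par o m n, ρ, δ => o.sem (m.sem ρ δ) (n.sem ρ δ)
  | .recur X m, ρ, δ =>
      (sInf {F : DInt DVar D | (fun δ' => m.sem (Function.update ρ X F) δ') ≤ F}) δ
  | .var X, ρ, δ => ρ X δ

theorem Formula.sem_synth {φ : Formula FVar DVar} (h : φ.IsCHML) (ρ : TEnv FVar DVar D)
    (δ : DEnv DVar D) : φ.synth.sem ρ δ = φ.sem ρ δ := by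
  induction φ generalizing ρ δ with
  | tt | var => rfl
  | ff | box | all | gfp => exact h.elim
  | dia b φ ih => simp only [synth, Mon.sem, sem, ih h]
  | ex x φ ih => simp only [synth, Mon.sem, sem, ih h]
  | or φ ψ ihφ ihψ => simp only [synth, Mon.sem, sem, ihφ h.1, ihψ h.2, ParOp.sem]
  | and φ ψ ihφ ihψ => simp only [synth, Mon.sem, sem, ihφ h.1, ihψ h.2, ParOp.sem]
  | lfp X φ ih => simp only [synth, Mon.sem, sem, ih h]

namespace Mon

theorem sem_mono (m : Mon FVar DVar) {ρ ρ' : TEnv FVar DVar D} (h : ρ ≤ ρ') (δ : DEnv DVar D) :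
    m.sem ρ δ ⊆ m.sem ρ' δ := by
  induction m generalizing ρ ρ' δ with
  | yes | inconclusive => exact subset_rfl
  | act b m ih => exact fun t ⟨d, u, ht, hb, hu⟩ => ⟨d, u, ht, hb, ih h δ hu⟩
  | guess x m ih => exact Set.iUnion_mono fun d => ih h _
  | par o m n ihm ihn => exact o.sem_mono (ihm h δ) (ihn h δ)
  | recur X m ih =>
    -- The larger environment has fewer pre-fixed points, so their infimum is larger.
    have key : {F : DInt DVar D | (fun δ' => m.sem (Function.update ρ' X F) δ') ≤ F} ⊆
        {F | (fun δ' => m.sem (Function.update ρ X F) δ') ≤ F} := by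
      intro F hF
      have hF' : (fun δ' => m.sem (Function.update ρ' X F) δ') ≤ F := hF
      refine le_trans (fun δ' => ih ?_ δ') hF'
      exact update_le_update_iff.2 ⟨le_rfl, fun Y _ => h Y⟩
    exact (sInf_le_sInf key : _ ≤ _) δ
  | var X => exact h X δ

theorem sem_congr {m : Mon FVar DVar} {ρ ρ' : TEnv FVar DVar D}
    (h : ∀ X ∈ m.freeFVars, ρ X = ρ' X) (δ : DEnv DVar D) : m.sem ρ δ = m.sem ρ' δ := by
  induction m generalizing ρ ρ' δ with
  | yes | inconclusive => rfl
  | act b m ih => simp only [sem, ih h]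
  | guess x m ih => simp only [sem, ih h]
  | par o m n ihm ihn =>
    simp only [sem, ihm fun X hX => h X (Or.inl hX), ihn fun X hX => h X (Or.inr hX)]
  | recur X m ih =>
    have key : ∀ (F : DInt DVar D) (δ' : DEnv DVar D),
        m.sem (Function.update ρ X F) δ' = m.sem (Function.update ρ' X F) δ' := by
      intro F δ'
      refine ih (fun Y hY => ?_) δ'
      by_cases hX : Y = X
      · subst hX
        rw [Function.update_self, Function.update_self]
      · rw [Function.update_of_ne hX, Function.update_of_ne hX, h Y ⟨hY, hX⟩]
    simp only [sem, key]
  | var X => exact congrFun (h X rfl) δ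

theorem sem_subst (m : Mon FVar DVar) (X : FVar) {n : Mon FVar DVar} (hn : n.freeFVars = ∅)
    (ρ : TEnv FVar DVar D) (δ : DEnv DVar D) :
    (m.subst X n).sem ρ δ = m.sem (Function.update ρ X (n.sem ρ)) δ := by
  induction m generalizing ρ δ with
  | yes | inconclusive => rfl
  | act b m ih => simp only [subst, sem, ih]
  | guess x m ih => simp only [subst, sem, ih]
  | par o m₁ m₂ ih₁ ih₂ => simp only [subst, sem, ih₁, ih₂]
  | recur Y m ih =>
    rw [subst]
    split_ifs with hY
    · subst hY
      simp only [sem, Function.update_idem]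
    -- Closedness of `n` enters here: its denotation ignores the value bound to `Y`, so the two
    -- updates commute.
    · have key : ∀ F : DInt DVar D, n.sem (Function.update ρ Y F) = n.sem ρ :=
        fun F => funext fun δ' => sem_congr (by simp [hn]) δ'
      simp only [sem, ih, key, Function.update_comm hY]
  | var Y =>
    rw [subst]
    split_ifs with hY
    · subst hY
      simp only [sem, Function.update_self]
    · simp only [sem, Function.update_of_ne hY]

/-- Park induction. With `sem_update_recur_subset` it is all that is used about least fixed points
of monitors; no approximants are needed. -/
theorem sem_recur_subset_of_le {X : FVar} {m : Mon FVar DVar} {ρ : TEnv FVar DVar D}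
    {F : DInt DVar D} (hF : ∀ δ, m.sem (Function.update ρ X F) δ ⊆ F δ) (δ : DEnv DVar D) :
    (recur X m).sem ρ δ ⊆ F δ :=
  have h : F ∈ {F : DInt DVar D | (fun δ' => m.sem (Function.update ρ X F) δ') ≤ F} := hF
  (sInf_le h : _ ≤ F) δ

/-- The denotation of a recursion is a pre-fixed point of its body. -/
theorem sem_update_recur_subset (X : FVar) (m : Mon FVar DVar) (ρ : TEnv FVar DVar D)
    (δ : DEnv DVar D) :
    m.sem (Function.update ρ X ((recur X m).sem ρ)) δ ⊆ (recur X m).sem ρ δ := by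
  have h : (fun δ' => m.sem (Function.update ρ X ((recur X m).sem ρ)) δ') ≤
      sInf {F : DInt DVar D | (fun δ' => m.sem (Function.update ρ X F) δ') ≤ F} := by
    refine le_sInf fun F hF => le_trans (fun δ' => sem_mono m ?_ δ') hF
    exact update_le_update_iff.2
      ⟨fun δ'' => sem_recur_subset_of_le hF δ'', fun Y _ => le_rfl⟩
  exact h δ

/-- The denotation of a monitor is open whenever its environment is. -/
theorem sem_subset_interior (m : Mon FVar DVar) {ρ : TEnv FVar DVar D}
    (h : ∀ X δ, ρ X δ ⊆ traceInterior (ρ X δ)) (δ : DEnv DVar D) :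
    m.sem ρ δ ⊆ traceInterior (m.sem ρ δ) := by
  induction m generalizing ρ δ with
  | yes => exact fun t _ => ⟨[], .nil t, fun _ => trivial⟩
  | inconclusive => exact Set.empty_subset _
  | act b m ih =>
    rintro _ ⟨d, u, rfl, hb, hu⟩
    obtain ⟨w, hw, hT⟩ := ih h δ hu
    exact ⟨d :: w, hw.cons d, fun v => ⟨d, w ++ₛ v, rfl, hb, hT v⟩⟩
  | guess x m ih =>
    exact Set.iUnion_subset fun d => (ih h _).trans
      (traceInterior_mono (Set.subset_iUnion (fun d => m.sem ρ (δ.update x d)) d))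
  | par o m n ihm ihn =>
    cases o with
    | oplus =>
      exact Set.union_subset ((ihm h δ).trans (traceInterior_mono Set.subset_union_left))
        ((ihn h δ).trans (traceInterior_mono Set.subset_union_right))
    | otimes =>
      rintro t ⟨hm, hn⟩
      obtain ⟨w, hw, hwT⟩ := ihm h δ hm
      obtain ⟨y, hy, hyT⟩ := ihn h δ hn
      rcases hw.total hy with ⟨z, rfl⟩ | ⟨z, rfl⟩
      -- The longer of the two prefixes witnesses both conjuncts.
      · refine ⟨_, hy, fun u => ⟨?_, hyT u⟩⟩
        rw [Stream'.append_append_stream]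
        exact hwT _
      · refine ⟨_, hw, fun u => ⟨hwT u, ?_⟩⟩
        rw [Stream'.append_append_stream]
        exact hyT _
  | recur X m ih =>
    -- Park induction with the interior of the denotation itself. This interior is open, so the body
    -- evaluated at it is open by `ih`; by monotonicity and the pre-fixed point property that value
    -- lies in the denotation, hence in its interior.
    refine sem_recur_subset_of_le (F := fun δ' => traceInterior ((recur X m).sem ρ δ'))
      (fun δ' => ?_) δ
    refine (ih (fun Y δ'' => ?_) δ').trans (traceInterior_mono
      ((sem_mono m ?_ δ').trans (sem_update_recur_subset X m ρ δ')))
    · by_cases hY : Y = X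
      · subst hY
        rw [Function.update_self]
        exact subset_traceInterior_traceInterior _
      · rw [Function.update_of_ne hY]
        exact h Y δ''
    · exact update_le_update_iff.2
        ⟨fun δ'' => traceInterior_subset _, fun Y _ => le_rfl⟩
  | var X => exact h X δ

end Mon

/-- The denotation of the dual is the complement, in the complemented environment. -/
theorem Formula.sem_dual (φ : Formula FVar DVar) (ρ : TEnv FVar DVar D) (δ : DEnv DVar D) :
    φ.dual.sem ρᶜ δ = (φ.sem ρ δ)ᶜ := by
  induction φ generalizing ρ δ with
  | tt => exact Set.compl_univ.symm
  | ff => exact Set.compl_empty.symm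
  | dia b φ ih =>
    ext t
    simp only [dual, sem, ih, Set.mem_ofPred_eq, Set.mem_compl_iff]
    grind
  | box b φ ih =>
    ext t
    simp only [dual, sem, ih, Set.mem_ofPred_eq, Set.mem_compl_iff]
    grind
  | ex x φ ih => simp only [dual, sem, ih, Set.compl_iUnion]
  | all x φ ih => simp only [dual, sem, ih, Set.compl_iInter]
  | or φ ψ ihφ ihψ => simp only [dual, sem, ihφ, ihψ, Set.compl_union]
  | and φ ψ ihφ ihψ => simp only [dual, sem, ihφ, ihψ, Set.compl_inter]
  | lfp X φ ih =>
    -- Complementation of F exchanges the pre-fixed points of the body with the post-fixed points of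
    -- its dual; the De Morgan law for `sInf` then finishes.
    have key : ∀ F : DInt DVar D, (fun δ' => φ.dual.sem (Function.update ρᶜ X F) δ') =
        (fun δ' => φ.sem (Function.update ρ X Fᶜ) δ')ᶜ := by
      intro F
      funext δ'
      have e : Function.update ρᶜ X F = (Function.update ρ X Fᶜ)ᶜ := by
        funext Y
        by_cases hY : Y = X
        · subst hY
          simp
        · simp [hY]
      rw [e, ih]
      rfl
    have := compl_sInf' (α := DInt DVar D)
      (s := {F | (fun δ' => φ.sem (Function.update ρ X F) δ') ≤ F})
    refine Eq.trans ?_ (congrFun this.symm δ)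
    refine congrFun (congrArg sSup ?_) δ
    ext F
    simp only [key, Set.mem_ofPred_eq]
    constructor
    · intro h
      exact ⟨Fᶜ, le_compl_comm.1 h, compl_compl F⟩
    · rintro ⟨G, hG, rfl⟩
      rw [compl_compl]
      exact compl_le_compl hG
  | gfp X φ ih =>
    have key : ∀ F : DInt DVar D, (fun δ' => φ.dual.sem (Function.update ρᶜ X F) δ') =
        (fun δ' => φ.sem (Function.update ρ X Fᶜ) δ')ᶜ := by
      intro F
      funext δ'
      have e : Function.update ρᶜ X F = (Function.update ρ X Fᶜ)ᶜ := by
        funext Y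
        by_cases hY : Y = X
        · subst hY
          simp
        · simp [hY]
      rw [e, ih]
      rfl
    have := compl_sSup' (α := DInt DVar D)
      (s := {F | F ≤ (fun δ' => φ.sem (Function.update ρ X F) δ')})
    refine Eq.trans ?_ (congrFun this.symm δ)
    refine congrFun (congrArg sInf ?_) δ
    ext F
    simp only [key, Set.mem_ofPred_eq]
    constructor
    · intro h
      exact ⟨Fᶜ, compl_le_iff_compl_le.1 h, compl_compl F⟩
    · rintro ⟨G, hG, rfl⟩
      rw [compl_compl]
      exact compl_le_compl hG
  | var X => rfl

end Denotation

/-! ## Synthesised monitors -/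

section Synthesis

variable {FVar DVar : Type*}

theorem Formula.freeFVars_synth {φ : Formula FVar DVar} (h : φ.IsCHML) :
    φ.synth.freeFVars = φ.freeFVars := by
  induction φ with
  | tt | var => rfl
  | ff | box | all | gfp => exact h.elim
  | dia b φ ih => exact ih h
  | ex x φ ih => exact ih h
  | or φ ψ ihφ ihψ => exact congrArg₂ _ (ihφ h.1) (ihψ h.2)
  | and φ ψ ihφ ihψ => exact congrArg₂ _ (ihφ h.1) (ihψ h.2)
  | lfp X φ ih => exact congrArg (· \ {X}) (ih h)

theorem Formula.freeDVars_synth {φ : Formula FVar DVar} (h : φ.IsCHML) :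
    φ.synth.freeDVars = φ.freeDVars := by
  induction φ with
  | tt | var => rfl
  | ff | box | all | gfp => exact h.elim
  | dia b φ ih => exact congrArg (b.vars ∪ ·) (ih h)
  | ex x φ ih => exact congrArg (· \ {x}) (ih h)
  | or φ ψ ihφ ihψ => exact congrArg₂ _ (ihφ h.1) (ihψ h.2)
  | and φ ψ ihφ ihψ => exact congrArg₂ _ (ihφ h.1) (ihψ h.2)
  | lfp X φ ih => exact ih h

theorem Formula.guardedIn_synth {φ : Formula FVar DVar} {X : FVar} (h : φ.GuardedIn X) :
    φ.synth.GuardedIn X := by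
  induction φ with
  | tt | ff | dia | box | all | gfp => trivial
  | var => exact h
  | ex x φ ih => exact ih h
  | or φ ψ ihφ ihψ => exact ⟨ihφ h.1, ihψ h.2⟩
  | and φ ψ ihφ ihψ => exact ⟨ihφ h.1, ihψ h.2⟩
  | lfp Y φ ih => exact h.imp id ih

theorem Formula.guarded_synth {φ : Formula FVar DVar} (h : φ.Guarded) : φ.synth.Guarded := by
  induction φ with
  | tt | ff | box | all | gfp | var => trivial
  | dia b φ ih => exact ih h
  | ex x φ ih => exact ih h
  | or φ ψ ihφ ihψ => exact ⟨ihφ h.1, ihψ h.2⟩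
  | and φ ψ ihφ ihψ => exact ⟨ihφ h.1, ihψ h.2⟩
  | lfp Y φ ih => exact ⟨guardedIn_synth h.1, ih h.2⟩

theorem Formula.IsSHML.dual {φ : Formula FVar DVar} (h : φ.IsSHML) : φ.dual.IsCHML := by
  induction φ with
  | ff | var => trivial
  | tt | dia | ex | lfp => exact h.elim
  | box b φ ih => exact ih h
  | all x φ ih => exact ih h
  | or φ ψ ihφ ihψ => exact ⟨ihφ h.1, ihψ h.2⟩
  | and φ ψ ihφ ihψ => exact ⟨ihφ h.1, ihψ h.2⟩
  | gfp Y φ ih => exact ih h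

theorem Formula.freeFVars_dual (φ : Formula FVar DVar) : φ.dual.freeFVars = φ.freeFVars := by
  induction φ <;> simp_all [Formula.dual, freeFVars]

theorem Formula.freeDVars_dual (φ : Formula FVar DVar) : φ.dual.freeDVars = φ.freeDVars := by
  induction φ <;> simp_all [Formula.dual, freeDVars]

theorem Formula.Closed.dual {φ : Formula FVar DVar} (h : φ.Closed) : φ.dual.Closed :=
  ⟨φ.freeFVars_dual.trans h.1, φ.freeDVars_dual.trans h.2⟩

theorem Formula.guardedIn_dual {φ : Formula FVar DVar} {X : FVar} :
    φ.dual.GuardedIn X ↔ φ.GuardedIn X := by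
  induction φ <;> simp_all [Formula.dual, GuardedIn]

theorem Formula.Guarded.dual {φ : Formula FVar DVar} (h : φ.Guarded) : φ.dual.Guarded := by
  induction φ <;> simp_all [Formula.dual, Guarded, guardedIn_dual]

variable {D : Type*} [DecidableEq FVar] [DecidableEq DVar] [DecidableEq D]

theorem Formula.traces_eq_sem_synth {φ : Formula FVar DVar} (h : φ.IsCHML) :
    φ.traces D = φ.synth.sem (fun _ _ => ∅) DEnv.empty :=
  (sem_synth h _ _).symm

/-- `sem_dual` also complements the environment. Closedness allows returning to the empty one,
through the synthesised monitor because `Mon.sem_congr` is stated for monitors. -/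
theorem Formula.traces_dual {φ : Formula FVar DVar} (h : φ.IsSHML) (hc : φ.Closed) :
    φ.dual.traces D = (φ.traces D)ᶜ := by
  rw [traces_eq_sem_synth h.dual, traces, ← sem_dual, ← sem_synth h.dual]
  refine Mon.sem_congr (fun X hX => ?_) _
  rw [freeFVars_synth h.dual, hc.dual.1] at hX
  exact hX.elim

theorem Formula.traces_subset_interior {φ : Formula FVar DVar} (h : φ.IsCHML) :
    φ.traces D ⊆ traceInterior (φ.traces D) := by
  rw [traces_eq_sem_synth h]
  exact Mon.sem_subset_interior _ (fun _ _ => Set.empty_subset _) _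

end Synthesis

section Runs

variable {FVar DVar D : Type*} [DecidableEq FVar] [DecidableEq DVar] [DecidableEq D]

/-! ## Soundness of runs -/

namespace Config

/-- No monitor in the configuration has a free recursion variable. -/
def Closed : Config FVar DVar D → Prop
  | .single m _ => m.freeFVars = ∅
  | .par _ c₁ c₂ => c₁.Closed ∧ c₂.Closed

/-- The set of traces that a configuration is meant to accept. -/
def sem : Config FVar DVar D → Set (Trace D)
  | .single m δ => m.sem (fun _ _ => ∅) δ
  | .par o c₁ c₂ => o.sem c₁.sem c₂.sem

end Config

theorem Mon.freeFVars_unfold {X : FVar} {m : Mon FVar DVar}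
    (h : (Mon.recur X m).freeFVars = ∅) : (m.subst X (.recur X m)).freeFVars = ∅ := by
  have := m.freeFVars_subst_subset X (.recur X m)
  rw [h, Set.union_empty] at this
  exact Set.subset_eq_empty this h

theorem Step.closed {l : Option D} {c c' : Config FVar DVar D} (h : Step l c c')
    (hc : c.Closed) : c'.Closed := by
  induction h with
  | vrdYes | vrdEnd | block => rfl
  | act d b m δ => exact hc
  | guess d x m δ => exact hc
  | unfold X m δ => exact Mon.freeFVars_unfold hc
  | fork o m n δ => exact Set.union_empty_iff.1 hc
  | sync d o c₁ c₁' c₂ c₂' h₁ h₂ ih₁ ih₂ => exact ⟨ih₁ hc.1, ih₂ hc.2⟩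
  | asyncL o c₁ c₁' c₂ h ih => exact ⟨ih hc.1, hc.2⟩
  | asyncR o c₁ c₂ c₂' h ih => exact ⟨hc.1, ih hc.2⟩
  | andYesL δ c => exact hc.2
  | andYesR δ c => exact hc.1
  | orYesL δ c => exact hc.1
  | orYesR δ c => exact hc.2

/-- Silent steps resolve choices: a guess selects one member of a union, and the verdict rules
discard neutral or absorbed components. Unfolding is `sem_subst` followed by the pre-fixed point
property, whence the closedness hypothesis. -/
theorem Step.sem_subset {c c' : Config FVar DVar D} (h : Step none c c') (hc : c.Closed) :
    c'.sem ⊆ c.sem := by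
  generalize hl : (none : Option D) = l at h
  induction h with
  | vrdYes | vrdEnd | act | block | sync => cases hl
  | guess d x m δ => exact Set.subset_iUnion (fun d => m.sem _ (δ.update x d)) d
  | unfold X m δ =>
    exact (Mon.sem_subst m X hc _ δ).subset.trans (Mon.sem_update_recur_subset X m _ δ)
  | fork o m n δ => exact subset_rfl
  | asyncL o c₁ c₁' c₂ h ih => exact o.sem_mono (ih hc.1 hl) subset_rfl
  | asyncR o c₁ c₂ c₂' h ih => exact o.sem_mono subset_rfl (ih hc.2 hl)
  | andYesL δ c => exact fun t ht => ⟨trivial, ht⟩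
  | andYesR δ c => exact fun t ht => ⟨ht, trivial⟩
  | orYesL δ c => exact Set.subset_union_left
  | orYesR δ c => exact Set.subset_union_right

theorem Step.cons_mem_sem {d : D} {c c' : Config FVar DVar D} (h : Step (some d) c c')
    {u : Trace D} (hu : u ∈ c'.sem) : Stream'.cons d u ∈ c.sem := by
  generalize hl : some d = l at h
  induction h with
  | guess | unfold | fork | asyncL | asyncR | andYesL | andYesR | orYesL | orYesR => cases hl
  | vrdYes => trivial
  | vrdEnd => exact hu
  | act e b m δ hb => cases hl; exact ⟨d, u, rfl, hb, hu⟩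
  | block => exact hu.elim
  | sync e o c₁ c₁' c₂ c₂' h₁ h₂ ih₁ ih₂ =>
    cases o with
    | oplus => exact hu.imp (ih₁ · hl) (ih₂ · hl)
    | otimes => exact ⟨ih₁ hu.1 hl, ih₂ hu.2 hl⟩

theorem TauSteps.closed {c c' : Config FVar DVar D} (h : TauSteps c c') (hc : c.Closed) :
    c'.Closed := by
  induction h with
  | refl => exact hc
  | tail _ h ih => exact h.closed ih

theorem TauSteps.sem_subset {c c' : Config FVar DVar D} (h : TauSteps c c') (hc : c.Closed) :
    c'.sem ⊆ c.sem := by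
  induction h with
  | refl => exact subset_rfl
  | tail h₁ h₂ ih => exact (h₂.sem_subset (TauSteps.closed h₁ hc)).trans ih

theorem WeakSteps.append_mem_sem {w : List D} {c c' : Config FVar DVar D} (h : WeakSteps w c c')
    (hc : c.Closed) {u : Trace D} (hu : u ∈ c'.sem) : w ++ₛ u ∈ c.sem := by
  induction w generalizing c with
  | nil => exact TauSteps.sem_subset h hc hu
  | cons d w ih =>
    obtain ⟨c₃, ⟨c₁, c₂, h₁, h₂, h₃⟩, h₄⟩ := h
    have hc₂ := h₂.closed (TauSteps.closed h₁ hc)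
    exact TauSteps.sem_subset h₁ hc (h₂.cons_mem_sem
      (TauSteps.sem_subset h₃ hc₂ (ih h₄ (TauSteps.closed h₃ hc₂))))

/-- The traces with a prefix on which the configuration reaches `yes`. -/
def Config.accepted (c : Config FVar DVar D) : Set (Trace D) :=
  {t | ∃ w, PrefixOf w t ∧ c.ReachesYes w}

theorem Config.accepted_subset_sem {c : Config FVar DVar D} (hc : c.Closed) :
    c.accepted ⊆ c.sem := by
  rintro _ ⟨w, ⟨u, rfl⟩, δ, h⟩
  exact h.append_mem_sem hc trivial

/-! ## Composition of runs -/

theorem TauSteps.par {o : ParOp} {c₁ c₁' c₂ c₂' : Config FVar DVar D} (h₁ : TauSteps c₁ c₁')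
    (h₂ : TauSteps c₂ c₂') : TauSteps (.par o c₁ c₂) (.par o c₁' c₂') :=
  (Relation.ReflTransGen.lift (fun c => Config.par o c c₂)
      (fun a b => Step.asyncL o a b c₂) _ _ h₁).trans
    (Relation.ReflTransGen.lift (fun c => Config.par o c₁' c)
      (fun a b => Step.asyncR o c₁' a b) _ _ h₂)

theorem WeakStep.par {d : D} {o : ParOp} {c₁ c₁' c₂ c₂' : Config FVar DVar D}
    (h₁ : WeakStep d c₁ c₁') (h₂ : WeakStep d c₂ c₂') :
    WeakStep d (.par o c₁ c₂) (.par o c₁' c₂') := by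
  obtain ⟨a, a', ha, haa, ha'⟩ := h₁
  obtain ⟨b, b', hb, hbb, hb'⟩ := h₂
  exact ⟨_, _, ha.par hb, .sync d o a a' b b' haa hbb, ha'.par hb'⟩

theorem WeakSteps.par {w : List D} {o : ParOp} {c₁ c₁' c₂ c₂' : Config FVar DVar D}
    (h₁ : WeakSteps w c₁ c₁') (h₂ : WeakSteps w c₂ c₂') :
    WeakSteps w (.par o c₁ c₂) (.par o c₁' c₂') := by
  induction w generalizing c₁ c₂ with
  | nil => exact TauSteps.par h₁ h₂
  | cons d w ih =>
    obtain ⟨a, ha, ha'⟩ := h₁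
    obtain ⟨b, hb, hb'⟩ := h₂
    exact ⟨_, ha.par hb, ih ha' hb'⟩

theorem WeakStep.head_tau {d : D} {c c' c'' : Config FVar DVar D} (h : TauSteps c c')
    (h' : WeakStep d c' c'') : WeakStep d c c'' := by
  obtain ⟨a, b, ha, hab, hb⟩ := h'
  exact ⟨a, b, Relation.ReflTransGen.trans h ha, hab, hb⟩

theorem WeakSteps.head_tau {w : List D} {c c' c'' : Config FVar DVar D} (h : TauSteps c c')
    (h' : WeakSteps w c' c'') : WeakSteps w c c'' := by
  cases w with
  | nil => exact Relation.ReflTransGen.trans h h'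
  | cons d w =>
    obtain ⟨a, ha, ha'⟩ := h'
    exact ⟨a, ha.head_tau h, ha'⟩

theorem WeakSteps.tail_tau {w : List D} {c c' c'' : Config FVar DVar D} (h : WeakSteps w c c')
    (h' : TauSteps c' c'') : WeakSteps w c c'' := by
  induction w generalizing c with
  | nil => exact Relation.ReflTransGen.trans h h'
  | cons d w ih =>
    obtain ⟨a, ha, ha'⟩ := h
    exact ⟨a, ha, ih ha'⟩

theorem Config.accepted_subset_of_step {c c' : Config FVar DVar D} (h : Step none c c') :
    c'.accepted ⊆ c.accepted :=
  fun _ ⟨w, hw, δ, h'⟩ => ⟨w, hw, δ, h'.head_tau (.single h)⟩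

/-! ## Progress of guarded monitors -/

/-- The environment is defined on all data variables in `V`. -/
def DEnv.Covers (δ : DEnv DVar D) (V : Set DVar) : Prop := ∀ x ∈ V, δ.val x ≠ none

theorem DEnv.Covers.update {δ : DEnv DVar D} {V : Set DVar} {x : DVar} (h : δ.Covers (V \ {x}))
    (d : D) : (δ.update x d).Covers V := by
  intro y hy
  by_cases hx : y = x
  · subst hx
    simp [DEnv.update]
  · simpa [DEnv.update, hx] using h y ⟨hy, hx⟩

theorem Exp.exists_eval {δ : DEnv DVar D} (e : Exp DVar) (h : δ.Covers e.vars) (d : D) :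
    ∃ a, e.eval δ d = some a := by
  cases e with
  | var x => exact Option.ne_none_iff_exists'.1 (h x rfl)
  | star => exact ⟨d, rfl⟩

/-- A prefix whose constraint is undefined has no transition at all, not even to `end`; this
excludes that way of getting stuck. -/
theorem BExp.exists_eval {δ : DEnv DVar D} (b : BExp DVar) (h : δ.Covers b.vars) (d : D) :
    ∃ a, b.eval δ d = some a := by
  induction b with
  | tru => exact ⟨true, rfl⟩
  | eq e f =>
    obtain ⟨a, ha⟩ := e.exists_eval (fun x hx => h x (Or.inl hx)) d
    obtain ⟨c, hc⟩ := f.exists_eval (fun x hx => h x (Or.inr hx)) d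
    exact ⟨decide (a = c), by rw [eval, ha, hc]; rfl⟩
  | not b ih =>
    obtain ⟨a, ha⟩ := ih h
    exact ⟨a.not, by rw [eval, ha]; rfl⟩
  | and b c ihb ihc =>
    obtain ⟨a, ha⟩ := ihb fun x hx => h x (Or.inl hx)
    obtain ⟨a', ha'⟩ := ihc fun x hx => h x (Or.inr hx)
    exact ⟨a.and a', by rw [eval, ha, ha']; rfl⟩

/-- A closed guarded monitor, run in an environment that defines its data variables. -/
structure Mon.Runnable (m : Mon FVar DVar) (δ : DEnv DVar D) : Prop where
  closed : m.freeFVars = ∅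
  guarded : m.Guarded
  covers : δ.Covers m.freeDVars

namespace Mon.Runnable

variable {m n : Mon FVar DVar} {δ : DEnv DVar D}

theorem of_act {b : BExp DVar} (h : (Mon.act b m).Runnable δ) : m.Runnable δ :=
  ⟨h.closed, h.guarded, fun x hx => h.covers x (Or.inr hx)⟩

theorem of_guess {x : DVar} (h : (Mon.guess x m).Runnable δ) (d : D) :
    m.Runnable (δ.update x d) :=
  ⟨h.closed, h.guarded, DEnv.Covers.update h.covers d⟩

theorem left {o : ParOp} (h : (Mon.par o m n).Runnable δ) : m.Runnable δ :=
  ⟨(Set.union_empty_iff.1 h.closed).1, h.guarded.1, fun x hx => h.covers x (Or.inl hx)⟩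

theorem right {o : ParOp} (h : (Mon.par o m n).Runnable δ) : n.Runnable δ :=
  ⟨(Set.union_empty_iff.1 h.closed).2, h.guarded.2, fun x hx => h.covers x (Or.inr hx)⟩

theorem unfold {X : FVar} (h : (Mon.recur X m).Runnable δ) :
    (m.subst X (.recur X m)).Runnable δ :=
  ⟨freeFVars_unfold h.closed, h.guarded.2.subst X h.closed h.guarded,
    fun x hx => h.covers x ((m.freeDVars_subst_subset X _ hx).elim id id)⟩

end Mon.Runnable

/-- All monitors in the configuration are runnable. -/
def Config.Runnable : Config FVar DVar D → Prop
  | .single m δ => m.Runnable δ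
  | .par _ c₁ c₂ => c₁.Runnable ∧ c₂.Runnable

/-- Induction on `unguardedSize`, since unfolding does not yield a structurally smaller monitor. The
size drops along guesses, forks and guarded unfoldings, so a verdict or a constraint prefix is
reached, and these can read `d`. -/
theorem Mon.Runnable.exists_weakStep [Nonempty D] {m : Mon FVar DVar} {δ : DEnv DVar D}
    (h : m.Runnable δ) (d : D) :
    ∃ c' : Config FVar DVar D, WeakStep d (.single m δ) c' ∧ c'.Runnable := by
  generalize hk : m.unguardedSize = k
  induction k using Nat.strong_induction_on generalizing m δ with
  | _ k ih =>
  subst hk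
  cases m with
  | yes => exact ⟨_, ⟨_, _, .refl, .vrdYes d δ, .refl⟩, h⟩
  | inconclusive => exact ⟨_, ⟨_, _, .refl, .vrdEnd d δ, .refl⟩, h⟩
  | act b m =>
    obtain ⟨a, ha⟩ := b.exists_eval (δ := δ) (fun x hx => h.covers x (Or.inl hx)) d
    cases a with
    | true => exact ⟨_, ⟨_, _, .refl, .act d b m δ ha, .refl⟩, h.of_act⟩
    | false =>
      exact ⟨_, ⟨_, _, .refl, .block d b m δ ha, .refl⟩, ⟨rfl, trivial, fun _ hx => hx.elim⟩⟩
  | guess x m =>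
    -- Any guess will do: the run only has to continue, not to succeed.
    obtain ⟨e⟩ := ‹Nonempty D›
    obtain ⟨c', hc', hr⟩ := ih _ (Nat.lt_succ_self _) (h.of_guess e) rfl
    exact ⟨c', hc'.head_tau (.single (.guess e x m δ)), hr⟩
  | par o m n =>
    obtain ⟨c₁, hc₁, hr₁⟩ := ih _ (by simp only [unguardedSize]; omega) h.left rfl
    obtain ⟨c₂, hc₂, hr₂⟩ := ih _ (by simp only [unguardedSize]; omega) h.right rfl
    exact ⟨_, (hc₁.par hc₂).head_tau (.single (.fork o m n δ)), hr₁, hr₂⟩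
  | recur X m =>
    obtain ⟨c', hc', hr⟩ := ih _
      (by rw [unguardedSize_subst h.guarded.1]; exact Nat.lt_succ_self _) h.unfold rfl
    exact ⟨c', hc'.head_tau (.single (.unfold X m δ)), hr⟩
  | var X => exact absurd h.closed (Set.singleton_nonempty X).ne_empty

theorem Config.Runnable.exists_weakStep [Nonempty D] {c : Config FVar DVar D} (h : c.Runnable)
    (d : D) : ∃ c', WeakStep d c c' ∧ c'.Runnable := by
  induction c with
  | single m δ => exact Mon.Runnable.exists_weakStep h d
  | par o c₁ c₂ ih₁ ih₂ =>
    obtain ⟨c₁', h₁, hr₁⟩ := ih₁ h.1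
    obtain ⟨c₂', h₂, hr₂⟩ := ih₂ h.2
    exact ⟨_, h₁.par h₂, hr₁, hr₂⟩

theorem Config.Runnable.exists_weakSteps [Nonempty D] {c : Config FVar DVar D} (h : c.Runnable)
    (w : List D) : ∃ c', WeakSteps w c c' := by
  induction w generalizing c with
  | nil => exact ⟨c, .refl⟩
  | cons d w ih =>
    obtain ⟨c₁, h₁, hr⟩ := h.exists_weakStep d
    obtain ⟨c', h'⟩ := ih hr
    exact ⟨c', c₁, h₁, h'⟩

/-! ## Completeness of runs -/

namespace Config

/-- The second component merely keeps pace along `w`, after which the `yes` of the first absorbs it.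
-/
theorem accepted_subset_oplus_left [Nonempty D] (c₁ : Config FVar DVar D)
    {c₂ : Config FVar DVar D} (h : c₂.Runnable) :
    c₁.accepted ⊆ (Config.par .oplus c₁ c₂).accepted := by
  rintro t ⟨w, hw, δ, h₁⟩
  obtain ⟨c', h₂⟩ := h.exists_weakSteps w
  exact ⟨w, hw, δ, (h₁.par h₂).tail_tau (.single (.orYesL δ c'))⟩

theorem accepted_subset_oplus_right [Nonempty D] {c₁ : Config FVar DVar D} (h : c₁.Runnable)
    (c₂ : Config FVar DVar D) : c₂.accepted ⊆ (Config.par .oplus c₁ c₂).accepted := by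
  rintro t ⟨w, hw, δ, h₂⟩
  obtain ⟨c', h₁⟩ := h.exists_weakSteps w
  exact ⟨w, hw, δ, (h₁.par h₂).tail_tau (.single (.orYesR δ c'))⟩

theorem inter_accepted_subset_otimes (c₁ c₂ : Config FVar DVar D) :
    c₁.accepted ∩ c₂.accepted ⊆ (Config.par .otimes c₁ c₂).accepted := by
  have key : ∀ w, c₁.ReachesYes w → c₂.ReachesYes w →
      (Config.par .otimes c₁ c₂).ReachesYes w := by
    rintro w ⟨δ₁, h₁⟩ ⟨δ₂, h₂⟩
    exact ⟨δ₂, (h₁.par h₂).tail_tau (.single (.andYesL δ₁ _))⟩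
  rintro t ⟨⟨w, hw, h₁⟩, y, hy, h₂⟩
  -- The components may reach `yes` at different times; irrevocability moves both verdicts to the
  -- longer prefix.
  rcases hw.total hy with hwy | hyw
  · exact ⟨y, hy, key y (h₁.mono hwy) h₂⟩
  · exact ⟨w, hw, key w h₁ (h₂.mono hyw)⟩

end Config

/-- Traces in the denotation of a monitor are accepted by its runnable instances, provided that this
holds for the monitors substituted for its free recursion variables. -/
theorem Mon.sem_subset_accepted_msubst [Nonempty D] (m : Mon FVar DVar)
    {σ : FVar → Mon FVar DVar} {ρ : TEnv FVar DVar D} {δ : DEnv DVar D}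
    (hσ : ∀ X, (σ X).freeFVars = ∅)
    (hρ : ∀ X δ', (σ X).Runnable δ' → ρ X δ' ⊆ (Config.single (σ X) δ').accepted)
    (h : (m.msubst σ).Runnable δ) :
    m.sem ρ δ ⊆ (Config.single (m.msubst σ) δ).accepted := by
  induction m generalizing σ ρ δ with
  | yes => exact fun t _ => ⟨[], .nil t, δ, .refl⟩
  | inconclusive => exact Set.empty_subset _
  | act b m ih =>
    rintro _ ⟨d, u, rfl, hb, hu⟩
    obtain ⟨w, hw, δ', h'⟩ := ih hσ hρ h.of_act hu
    exact ⟨d :: w, hw.cons d, δ', _, ⟨_, _, .refl, .act d b _ δ hb, .refl⟩, h'⟩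
  | guess x m ih =>
    exact Set.iUnion_subset fun d => (ih hσ hρ (h.of_guess d)).trans
      (Config.accepted_subset_of_step (.guess d x _ δ))
  | par o m n ihm ihn =>
    refine Set.Subset.trans ?_ (Config.accepted_subset_of_step (.fork o _ _ δ))
    have hm := ihm hσ hρ h.left
    have hn := ihn hσ hρ h.right
    cases o with
    | oplus =>
      exact Set.union_subset (hm.trans (Config.accepted_subset_oplus_left _ h.right))
        (hn.trans (Config.accepted_subset_oplus_right (c₁ := .single _ δ) h.left _))
    | otimes => exact (Set.inter_subset_inter hm hn).trans (Config.inter_accepted_subset_otimes _ _)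
  | recur X m ih =>
    set r := (Mon.recur X m).msubst σ with hr
    have hsub : (m.msubst (Function.update σ X (.var X))).subst X r =
        m.msubst (Function.update σ X r) :=
      msubst_update_var_subst m r fun Y _ => by simp [hσ]
    -- The least fixed point ranges over all environments, including those leaving data variables of
    -- `r` undefined, where runs may be stuck. Making the candidate conditional on runnability
    -- imposes nothing there.
    have hF : (Mon.recur X m).sem ρ δ ⊆
        {t | r.Runnable δ → t ∈ (Config.single r δ).accepted} := by
      refine sem_recur_subset_of_le
        (F := fun δ' => {t | r.Runnable δ' → t ∈ (Config.single r δ').accepted})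
        (fun δ' t ht hr' => ?_) δ
      refine Config.accepted_subset_of_step (.unfold X _ δ') ?_
      have hrun := hr'.unfold
      change _ ∈ (Config.single ((m.msubst (Function.update σ X (.var X))).subst X r) δ').accepted
      change ((m.msubst (Function.update σ X (.var X))).subst X r).Runnable δ' at hrun
      rw [hsub] at hrun ⊢
      refine ih (fun Y => ?_) (fun Y δ'' hY => ?_) hrun ht
      · by_cases hYX : Y = X
        · subst hYX
          rw [Function.update_self]
          exact h.closed
        · rw [Function.update_of_ne hYX]
          exact hσ Y
      · by_cases hYX : Y = X
        · subst hYX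
          rw [Function.update_self] at hY ⊢
          rw [Function.update_self]
          -- At `X` the environment holds the candidate itself, so the required inclusion is its
          -- definition.
          exact fun t ht => ht hY
        · rw [Function.update_of_ne hYX] at hY ⊢
          rw [Function.update_of_ne hYX]
          exact hρ Y δ'' hY
    exact fun t ht => hF ht h
  | var X => exact hρ X δ h

theorem Mon.Runnable.sem_eq_accepted [Nonempty D] {m : Mon FVar DVar} {δ : DEnv DVar D}
    (h : m.Runnable δ) :
    m.sem (fun _ _ => ∅) δ = (Config.single m δ).accepted := by
  refine Set.Subset.antisymm ?_ (Config.accepted_subset_sem (c := .single m δ) h.closed)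
  -- The induction asks for closed substitutes, which excludes the identity substitution. As `m` is
  -- closed, any closed choice leaves it unchanged, and the empty ρ makes the condition on it
  -- trivial.
  have hm : m.msubst (fun _ => .yes) = m := msubst_eq_self (by simp [h.closed])
  have := m.sem_subset_accepted_msubst (σ := fun _ => .yes) (ρ := fun _ _ => ∅) (δ := δ)
    (fun _ => rfl) (fun _ _ _ => Set.empty_subset _) (hm.symm ▸ h)
  rwa [hm] at this

theorem Formula.runnable_synth {φ : Formula FVar DVar} (h : φ.IsCHML) (hc : φ.Closed)
    (hg : φ.Guarded) : φ.synth.Runnable (DEnv.empty : DEnv DVar D) where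
  closed := (freeFVars_synth h).trans hc.1
  guarded := guarded_synth hg
  covers := by
    intro x hx
    rw [freeDVars_synth h, hc.2] at hx
    exact hx.elim

theorem Formula.traces_eq_accepted [Nonempty D] {φ : Formula FVar DVar} (h : φ.IsCHML)
    (hc : φ.Closed) (hg : φ.Guarded) :
    φ.traces D = (Config.single φ.synth (DEnv.empty : DEnv DVar D)).accepted :=
  (traces_eq_sem_synth h).trans (runnable_synth h hc hg).sem_eq_accepted

end Runs

end RecHMLd

theorem mainTheorem2 {D FVar DVar : Type*} [Countable D] [Infinite D] [DecidableEq D]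
    [DecidableEq FVar] [DecidableEq DVar] :
    -- the monitor synthesised from a formula of cHMLd is sound and satisfaction-complete
    (∀ φ : RecHMLd.Formula FVar DVar, φ.IsCHML → φ.Closed → φ.Guarded →
      (φ.synth.acceptor D).Sound (φ.traces D) ∧
      (φ.synth.acceptor D).CompleteForSatisfactions (φ.traces D)) ∧
    -- cHMLd is completely monitorable for satisfactions
    (∀ φ : RecHMLd.Formula FVar DVar, φ.IsCHML → φ.Closed →
      RecHMLd.CompletelyMonitorableForSatisfactions (φ.traces D)) ∧
    -- the dual synthesis on sHMLd is sound and violation-complete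
    (∀ φ : RecHMLd.Formula FVar DVar, φ.IsSHML → φ.Closed → φ.Guarded →
      (φ.dual.synth.rejector D).Sound (φ.traces D) ∧
      (φ.dual.synth.rejector D).CompleteForViolations (φ.traces D)) ∧
    -- sHMLd is completely monitorable for violations
    (∀ φ : RecHMLd.Formula FVar DVar, φ.IsSHML → φ.Closed →
      RecHMLd.CompletelyMonitorableForViolations (φ.traces D)) := by
  refine ⟨fun φ h hc hg => ?_, fun φ h _ => ?_, fun φ h hc hg => ?_, fun φ h hc => ?_⟩
  -- Acceptance by `acceptor` is by definition membership in `Config.accepted`, so both halves are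
  -- read off this equality.
  · have e := RecHMLd.Formula.traces_eq_accepted (D := D) h hc hg
    exact ⟨⟨fun t ht => e.symm.subset ht, fun t ht => ht.elim fun _ h => h.2.elim⟩,
      fun t ht => e.subset ht⟩
  · exact RecHMLd.completelyMonitorableForSatisfactions_of_subset_interior
      (RecHMLd.Formula.traces_subset_interior h)
  -- The complement of the denotation equals the set of traces on which the dual's monitor reaches
  -- `yes`, that is, those rejected.
  · have e := (RecHMLd.Formula.traces_dual (D := D) h hc).symm.trans
      (RecHMLd.Formula.traces_eq_accepted h.dual hc.dual hg.dual)
    exact ⟨⟨fun t ht => ht.elim fun _ h => h.2.elim, fun t ht => e.symm.subset ht⟩,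
      fun t ht => e.subset ht⟩
  · refine RecHMLd.completelyMonitorableForViolations_of_compl_subset_interior ?_
    rw [← RecHMLd.Formula.traces_dual h hc]
    exact RecHMLd.Formula.traces_subset_interior h.dual
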